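/- Fix an integer $r\ge 2$. For each $n\ge 1$ let $H_n^{(1)}$ and $H_n^{(2)}$ be two $r$-uniform hypergraphs with the same finite vertex set $V_n$ (a hyperedge is an $r$-element subset of $V_n$, and no hyperedge is repeated within a hypergraph). Let $(c_n)$ be a sequence of positive integers with $c_n\to\infty$. For each $n$, color the vertices of $V_n$ independently and uniformly at random with $c_n$ colors: the colors $X_v$, $v\in V_n$, are independent, and $\mathbb P(X_v=a)=1/c_n$ for each $a\in\{1,\dots,c_n\}$. For $i\in\{1,2\}$ let $$T(H_n^{(i)})=\sum_{e\in E(H_n^{(i)})}\mathbf 1\{X_v=X_{v'}\text{ for all }v,v'\in e\}$$ be the number of monochromatic hyperedges of $H_n^{(i)}$; both counts are taken under the same coloring of $V_n$. Let $\lambda_1,\lambda_2,\lambda_{1,2}\ge 0$ be constants with $\lambda_{1,2}\le\lambda_1$ and $\lambda_{1,2}\le\lambda_2$, and suppose that, as $n\to\infty$, $$\mathbb E[T(H_n^{(i)})]\to\lambda_i,\qquad \operatorname{Var}[T(H_n^{(i)})]\to\lambda_i\quad(i=1,2),\qquad \operatorname{Cov}[T(H_n^{(1)}),T(H_n^{(2)})]\to\lambda_{1,2}.$$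 Then $$\bigl(T(H_n^{(1)}),\,T(H_n^{(2)})\bigr)\xrightarrow{d}\bigl(Z_1+Z_{1,2},\;Z_2+Z_{1,2}\bigr)\qquad(n\to\infty),$$ where $Z_1\sim\mathrm{Pois}(\lambda_1-\lambda_{1,2})$, $Z_2\sim\mathrm{Pois}(\lambda_2-\lambda_{1,2})$ and $Z_{1,2}\sim\mathrm{Pois}(\lambda_{1,2})$ are independent (and $\mathrm{Pois}(0)$ is the point mass at $0$). -/

import Mathlib

open MeasureTheory ProbabilityTheory Filter
open scoped NNReal Topology

namespace HypergraphColoring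

/-- A hypergraph is `r`-uniform if every hyperedge has exactly `r` vertices. -/
def IsUniform {V : Type*} (H : Hypergraph V) (r : ℕ) : Prop :=
  ∀ e ∈ H.edgeSet, e.encard = r

/-- A hyperedge `e` is monochromatic under the coloring `x` if all its vertices have the
same color. -/
def IsMonochromatic {V κ : Type*} (x : V → κ) (e : Set V) : Prop :=
  ∀ v ∈ e, ∀ v' ∈ e, x v = x v'

/-- `T(H)`: the number of monochromatic hyperedges of `H` under the coloring `x`. -/
noncomputable def monoCount {V κ : Type*} (H : Hypergraph V) (x : V → κ) : ℕ :=
  {e ∈ H.edgeSet | IsMonochromatic x e}.ncard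

/-- The family `X` of random variables on the probability space `(Ω, P)` colors each vertex
`v : V` uniformly at random with one of `c` colors, independently of the other vertices. -/
structure IsUniformColoring {V Ω : Type*} [MeasurableSpace Ω] (P : Measure Ω) (c : ℕ)
    (X : V → Ω → Fin c) : Prop where
  measurable : ∀ v, Measurable (X v)
  uniform : ∀ v a, P.real {ω | X v ω = a} = 1 / (c : ℝ)
  indep : iIndepFun X P

/-- The random number `T(H)` of monochromatic hyperedges of `H` under the random coloring `X`,
as a real random variable. -/
noncomputable def T {V Ω κ : Type*} (H : Hypergraph V) (X : V → Ω → κ) (ω : Ω) : ℝ :=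
  (monoCount H (fun v => X v ω) : ℝ)

end HypergraphColoring

/-! Let `p = monoProb c r` be the probability that an edge is monochromatic, and let `S` be the sum
of the indicators of the edges of `E₁ ∪ E₂`, weighted by `s` on `E₁` plus `t` on `E₂`. The joint
characteristic function at `(s, t)` is `φ 1`, where `φ u = 𝔼 exp(iuS)`.

Differentiating gives terms `i w_e 𝔼[1_e exp(iuS)]`. Given that `e` is monochromatic, a uniform
coloring is distributed as one with `e` recolored by the color of a vertex `v ∈ e`. Usually this
adds just `w_e` to `S`, so `φ' ≈ ψ' φ` with `ψ u = Σ p (exp(iu w_e) - 1)`, and an integrating factor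
gives `φ 1 ≈ exp (ψ 1)` (`norm_avg_exp_edgeSum_sub_le`). The weights `s`, `t`, `s + t` yield the
three Poisson variables.

The error comes from edges meeting `e` outside `v`. Pairs with at most one common vertex are
independent, but a star has many of them; taking `v` of maximal degree in `e` removes those sharing
only the hub. Cauchy–Schwarz bounds the rest by the number of pairs with two common vertices
(`sum_codegree_erase_le`), so only `overlap` must vanish.

All pair covariances are nonnegative. Since mean and variance share a limit, off-diagonal covariance
vanishes in each layer, and with it `overlap` (`tendsto_overlap`). For the union, cross pairs are
handled by `codegreeEnergy`, a quadratic expression in codegrees that is comparable to `overlap` up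
to a vanishing diagonal term. Finally the covariance hypothesis identifies the limit of `#(E₁ ∩ E₂)
* p` as `λ₁₂`. -/

namespace HypergraphColoring

open Finset

/-! ### Averages over all colorings -/

section Average

variable {V : Type*} [Fintype V] [DecidableEq V] {c : ℕ} {M : Type*} [AddCommGroup M] [Module ℝ M]

/-- The average of `F` over all colorings of `V` with `c` colors. -/
noncomputable def avg (F : (V → Fin c) → M) : M :=
  ((c : ℝ) ^ Fintype.card V)⁻¹ • ∑ x, F x

lemma avg_add (F G : (V → Fin c) → M) : avg (fun x => F x + G x) = avg F + avg G := by
  simp [avg, sum_add_distrib]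

lemma avg_sub (F G : (V → Fin c) → M) : avg (fun x => F x - G x) = avg F - avg G := by
  simp [avg, sum_sub_distrib, smul_sub]

lemma avg_sum {ι : Type*} (s : Finset ι) (F : ι → (V → Fin c) → M) :
    avg (fun x => ∑ i ∈ s, F i x) = ∑ i ∈ s, avg (F i) := by
  simp only [avg]
  rw [sum_comm, smul_sum]

lemma avg_const_mul {𝕜 : Type*} [RCLike 𝕜] (a : 𝕜) (F : (V → Fin c) → 𝕜) :
    avg (fun x => a * F x) = a * avg F := by
  simp only [avg, ← mul_sum, mul_smul_comm]

lemma avg_mono {F G : (V → Fin c) → ℝ} (h : ∀ x, F x ≤ G x) : avg F ≤ avg G := by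
  simp only [avg, smul_eq_mul]
  gcongr with x
  exact h x

lemma norm_avg_le {W : Type*} [NormedAddCommGroup W] [NormedSpace ℝ W] (F : (V → Fin c) → W) :
    ‖avg F‖ ≤ avg (fun x => ‖F x‖) := by
  simp only [avg, norm_smul, smul_eq_mul]
  rw [Real.norm_of_nonneg (by positivity)]
  gcongr
  exact norm_sum_le _ _

lemma avg_const (hc : 0 < c) (a : M) : avg (fun _ : V → Fin c => a) = a := by
  have : (c : ℝ) ^ Fintype.card V ≠ 0 := by positivity
  simp [avg, ← Nat.cast_smul_eq_nsmul ℝ, smul_smul, this]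

end Average

/-! ### Monochromatic indicators and recoloring -/

section Monochromatic

variable {V : Type*} {κ : Type*}

open Classical in
/-- The indicator function of the event that `e` is monochromatic. -/
noncomputable def monoInd (e : Finset V) (x : V → κ) : ℝ :=
  if IsMonochromatic x (e : Set V) then 1 else 0

lemma monoInd_nonneg (e : Finset V) (x : V → κ) : 0 ≤ monoInd e x := by
  unfold monoInd; split_ifs <;> simp

lemma monoInd_mul_self (e : Finset V) (x : V → κ) : monoInd e x * monoInd e x = monoInd e x := by
  unfold monoInd; split_ifs <;> simp

lemma monoInd_eq_zero_or_one (e : Finset V) (x : V → κ) : monoInd e x = 0 ∨ monoInd e x = 1 := by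
  unfold monoInd; split_ifs <;> simp

lemma monoInd_congr {e : Finset V} {x y : V → κ} (h : ∀ u ∈ e, x u = y u) :
    monoInd e x = monoInd e y := by
  have : IsMonochromatic x (e : Set V) ↔ IsMonochromatic y (e : Set V) := by
    simp only [IsMonochromatic, mem_coe]
    exact ⟨fun H a ha b hb => by rw [← h a ha, ← h b hb]; exact H a ha b hb,
      fun H a ha b hb => by rw [h a ha, h b hb]; exact H a ha b hb⟩
  by_cases hx : IsMonochromatic x (e : Set V)
  · rw [monoInd, monoInd, if_pos hx, if_pos (this.1 hx)]
  · rw [monoInd, monoInd, if_neg hx, if_neg (mt this.2 hx)]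

variable [DecidableEq V]

lemma monoInd_mul_of_inter_nonempty {e f : Finset V} (h : (e ∩ f).Nonempty) (x : V → κ) :
    monoInd e x * monoInd f x = monoInd (e ∪ f) x := by
  classical
  obtain ⟨v, hv⟩ := h
  rw [mem_inter] at hv
  have key : IsMonochromatic x ((e ∪ f : Finset V) : Set V) ↔
      IsMonochromatic x (e : Set V) ∧ IsMonochromatic x (f : Set V) := by
    simp only [IsMonochromatic, mem_coe, mem_union]
    refine ⟨fun h => ⟨fun a ha b hb => h a (.inl ha) b (.inl hb),
      fun a ha b hb => h a (.inr ha) b (.inr hb)⟩, fun ⟨h1, h2⟩ => ?_⟩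
    have : ∀ a, a ∈ e ∨ a ∈ f → x a = x v := fun a ha =>
      ha.elim (fun ha => h1 a ha v hv.1) (fun ha => h2 a ha v hv.2)
    exact fun a ha b hb => (this a ha).trans (this b hb).symm
  simp only [monoInd, key]
  split_ifs <;> simp_all

/-- The coloring obtained from `x` by giving every vertex of `e` the color of `v`. -/
def recolor (e : Finset V) (v : V) (x : V → κ) : V → κ := fun u => if u ∈ e then x v else x u

lemma monoInd_recolor_self (e : Finset V) (v : V) (x : V → κ) :
    monoInd e (recolor e v x) = 1 := by
  have : IsMonochromatic (recolor e v x) (e : Set V) := by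
    intro a ha b hb
    simp only [mem_coe] at ha hb
    simp [recolor, ha, hb]
  simp [monoInd, this]

lemma monoInd_recolor_of_disjoint {e f : Finset V} {v : V} (h : Disjoint f (e.erase v))
    (x : V → κ) : monoInd f (recolor e v x) = monoInd f x := by
  refine monoInd_congr fun u hu => ?_
  unfold recolor
  split_ifs with hue
  · have : u = v := by
      by_contra huv
      exact disjoint_left.1 h hu (mem_erase.2 ⟨huv, hue⟩)
    rw [this]
  · rfl

end Monochromatic

/-! ### Probabilities of one or two monochromatic edges -/

section Probabilities

variable {V : Type*} [Fintype V] [DecidableEq V] {c : ℕ}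

/-- The probability that `s` given vertices are monochromatic in a uniform coloring with `c`
colors. -/
noncomputable def monoProb (c s : ℕ) : ℝ := ((c : ℝ) ^ (s - 1))⁻¹

lemma monoProb_nonneg (c s : ℕ) : 0 ≤ monoProb c s := by unfold monoProb; positivity

lemma monoProb_anti (hc : 0 < c) {s t : ℕ} (h : s ≤ t) : monoProb c t ≤ monoProb c s := by
  unfold monoProb
  have : (1 : ℝ) ≤ c := by exact_mod_cast hc
  gcongr

lemma mul_monoProb_succ (hc : 0 < c) {s : ℕ} (hs : 1 ≤ s) :
    c * monoProb c (s + 1) = monoProb c s := by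
  have : (c : ℝ) ≠ 0 := by positivity
  obtain ⟨s, rfl⟩ := Nat.exists_eq_add_of_le' hs
  simp only [monoProb, Nat.add_sub_cancel, pow_succ]
  field_simp

lemma monoProb_mul_monoProb {r : ℕ} (hr : 1 ≤ r) :
    monoProb c r * monoProb c r = monoProb c (2 * r - 1) := by
  simp only [monoProb, ← mul_inv, ← pow_add]
  congr 2
  omega

-- A preimage of `y` must agree with `y` off `e` and at `v`, and is free on the other `#e - 1`
-- vertices of `e`. The count does not depend on `y`, which is why recoloring produces the
-- conditional law.
open Classical in
lemma card_recolor_fiber {e : Finset V} {v : V} (hv : v ∈ e) {y : V → Fin c}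
    (hy : IsMonochromatic y (e : Set V)) :
    #{x : V → Fin c | recolor e v x = y} = c ^ (#e - 1) := by
  have : ({x : V → Fin c | recolor e v x = y} : Finset _) =
      Fintype.piFinset fun u => if u ∈ e.erase v then univ else {y u} := by
    ext x
    simp only [mem_filter, mem_univ, true_and, Fintype.mem_piFinset]
    constructor
    · rintro rfl u
      split_ifs with h
      · simp
      · by_cases hu : u ∈ e
        · have : u = v := by simpa [hu] using h
          simp [recolor, this]
        · simp [recolor, hu]
    · intro h
      ext1 u
      have hxv : x v = y v := by simpa using h v
      by_cases hu : u ∈ e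
      · simp only [recolor, hu, if_true]
        rw [hxv]; exact hy v hv u hu
      · simpa [recolor, hu] using h u
  rw [this, Fintype.card_piFinset]
  have : ∀ u, #(if u ∈ e.erase v then (univ : Finset (Fin c)) else {y u}) =
      if u ∈ e.erase v then c else 1 := fun u => by split_ifs <;> simp
  rw [prod_congr rfl fun u _ => this u, prod_ite_mem, univ_inter, prod_const, card_erase_of_mem hv]

/-- Conditionally on `e` being monochromatic, a uniform coloring is distributed as its
recoloring. -/
lemma avg_monoInd_smul {M : Type*} [AddCommGroup M] [Module ℝ M] (hc : 0 < c) {e : Finset V}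
    {v : V} (hv : v ∈ e) (F : (V → Fin c) → M) :
    avg (fun x => monoInd e x • F x) = monoProb c #e • avg (fun x => F (recolor e v x)) := by
  classical
  have h1 : ∑ x, F (recolor e v x) =
      ∑ y, (c : ℝ) ^ (#e - 1) • (monoInd e y • F y) := by
    rw [← sum_fiberwise univ (recolor e v)]
    refine sum_congr rfl fun y _ => ?_
    rw [sum_congr rfl (g := fun _ => F y) (by simp +contextual), sum_const]
    by_cases hy : IsMonochromatic y (e : Set V)
    · rw [card_recolor_fiber hv hy, ← Nat.cast_smul_eq_nsmul ℝ]
      simp [monoInd, hy]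
    · have : #{x : V → Fin c | recolor e v x = y} = 0 := by
        rw [card_eq_zero, filter_eq_empty_iff]
        rintro x - rfl
        have := monoInd_recolor_self e v x
        simp [monoInd, hy] at this
      rw [this]
      simp [monoInd, hy]
  have h2 : (c : ℝ) ^ (#e - 1) ≠ 0 := by positivity
  rw [avg, avg, h1, ← smul_sum, monoProb, smul_comm, smul_smul ((c : ℝ) ^ (#e - 1))⁻¹,
    inv_mul_cancel₀ h2, one_smul]

lemma avg_monoInd (hc : 0 < c) {e : Finset V} (he : e.Nonempty) :
    avg (fun x : V → Fin c => monoInd e x) = monoProb c #e := by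
  obtain ⟨v, hv⟩ := he
  simpa [avg_const hc] using avg_monoInd_smul hc hv (fun _ : V → Fin c => (1 : ℝ))

/-- The probability that `e` and `f` are both monochromatic. -/
noncomputable def pairProb (c : ℕ) (e f : Finset V) : ℝ :=
  avg (fun x : V → Fin c => monoInd e x * monoInd f x)

lemma pairProb_eq_mul_recolor (hc : 0 < c) {e : Finset V} {v : V} (hv : v ∈ e) (f : Finset V) :
    pairProb c e f = monoProb c #e * avg (fun x : V → Fin c => monoInd f (recolor e v x)) := by
  simpa [pairProb] using avg_monoInd_smul hc hv (fun x : V → Fin c => monoInd f x)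

lemma pairProb_self (hc : 0 < c) {e : Finset V} (he : e.Nonempty) :
    pairProb c e e = monoProb c #e := by
  simp only [pairProb, monoInd_mul_self, avg_monoInd hc he]

lemma pairProb_of_inter_nonempty (hc : 0 < c) {r : ℕ} {e f : Finset V} (he : #e = r) (hf : #f = r)
    (h : (e ∩ f).Nonempty) : pairProb c e f = monoProb c (2 * r - #(e ∩ f)) := by
  simp only [pairProb, monoInd_mul_of_inter_nonempty h]
  rw [avg_monoInd hc (h.mono (inter_subset_left.trans subset_union_left)), card_union, he, hf,
    two_mul]

/-- Disjoint edges are independent; edges sharing one vertex have a union of `2r - 1` vertices,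
whose exponent `2r - 2` is again that of the product. -/
lemma pairProb_of_card_inter_le_one (hc : 0 < c) {r : ℕ} (hr : 1 ≤ r) {e f : Finset V}
    (he : #e = r) (hf : #f = r) (h : #(e ∩ f) ≤ 1) :
    pairProb c e f = monoProb c r * monoProb c r := by
  have hfn : f.Nonempty := card_pos.1 (by omega)
  obtain h0 | h0 := (e ∩ f).eq_empty_or_nonempty
  · obtain ⟨v, hv⟩ : e.Nonempty := card_pos.1 (by omega)
    have hd : Disjoint f (e.erase v) :=
      (disjoint_iff_inter_eq_empty.2 h0).symm.mono_right (erase_subset _ _)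
    rw [pairProb_eq_mul_recolor hc hv]
    simp only [monoInd_recolor_of_disjoint hd]
    rw [avg_monoInd hc hfn, he, hf]
  · rw [pairProb_of_inter_nonempty hc he hf h0, monoProb_mul_monoProb hr]
    have := card_pos.2 h0
    congr 2
    omega

/-- The union has at most `2r - 2` vertices, which saves one factor `c` over independence. -/
lemma mul_sq_monoProb_le_pairProb (hc : 0 < c) {r : ℕ} (hr : 1 ≤ r) {e f : Finset V}
    (he : #e = r) (hf : #f = r) (h : 2 ≤ #(e ∩ f)) :
    c * (monoProb c r * monoProb c r) ≤ pairProb c e f := by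
  have hle : #(e ∩ f) ≤ r := he ▸ card_le_card inter_subset_left
  rw [pairProb_of_inter_nonempty hc he hf (card_pos.1 (by omega)), monoProb_mul_monoProb hr,
    show 2 * r - 1 = (2 * r - 2) + 1 by omega, mul_monoProb_succ hc (by omega)]
  exact monoProb_anti hc (by omega)

lemma sq_monoProb_le_pairProb (hc : 0 < c) {r : ℕ} (hr : 1 ≤ r) {e f : Finset V}
    (he : #e = r) (hf : #f = r) : monoProb c r * monoProb c r ≤ pairProb c e f := by
  obtain h | h := le_or_gt #(e ∩ f) 1
  · exact (pairProb_of_card_inter_le_one hc hr he hf h).ge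
  · refine le_trans ?_ (mul_sq_monoProb_le_pairProb hc hr he hf h)
    have : (1 : ℝ) ≤ c := by exact_mod_cast hc
    have := mul_self_nonneg (monoProb c r)
    nlinarith

lemma pairProb_nonneg (e f : Finset V) : 0 ≤ pairProb c e f := by
  simp only [pairProb, avg, smul_eq_mul]
  have (x : V → Fin c) : 0 ≤ monoInd e x * monoInd f x :=
    mul_nonneg (monoInd_nonneg _ _) (monoInd_nonneg _ _)
  have := sum_nonneg fun x (_ : x ∈ univ) => this x
  positivity

end Probabilities

/-! ### Stability of a linear differential equation -/

/-- If `φ` almost solves the linear equation `φ' = ψ' φ` with `φ 0 = 1`, then `φ 1` is close to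
`exp (ψ 1)`. -/
lemma norm_sub_exp_le_of_deriv {φ ψ φ' ψ' : ℝ → ℂ} {η B : ℝ} (hφ : ∀ s, HasDerivAt φ (φ' s) s)
    (hψ : ∀ s, HasDerivAt ψ (ψ' s) s) (hφ0 : φ 0 = 1) (hψ0 : ψ 0 = 0)
    (hψ1 : (ψ 1).re ≤ 0) (hB : ∀ s, -B ≤ (ψ s).re) (h : ∀ s, ‖φ' s - ψ' s * φ s‖ ≤ η) :
    ‖φ 1 - Complex.exp (ψ 1)‖ ≤ η * Real.exp B := by
  -- Integrating factor: the derivative of `φ exp(-ψ)` is bounded by `η exp B`.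
  have hd : ∀ s, HasDerivAt (fun s => φ s * Complex.exp (-ψ s))
      ((φ' s - ψ' s * φ s) * Complex.exp (-ψ s)) s := fun s => by
    convert! (hφ s).mul (hψ s).neg.cexp using 1
    rw [Pi.neg_apply]
    ring
  have hη : 0 ≤ η := (norm_nonneg _).trans (h 0)
  have key := norm_image_sub_le_of_norm_deriv_le_segment_01' (C := η * Real.exp B)
    (fun s _ => (hd s).hasDerivWithinAt) (fun s _ => by
      rw [norm_mul, Complex.norm_exp, Complex.neg_re]
      gcongr
      · exact h s
      · linarith [hB s])
  rw [hφ0, hψ0, neg_zero, Complex.exp_zero, mul_one] at key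
  have : φ 1 - Complex.exp (ψ 1) = (φ 1 * Complex.exp (-ψ 1) - 1) * Complex.exp (ψ 1) := by
    rw [sub_mul, mul_assoc, ← Complex.exp_add]; simp
  rw [this, norm_mul, Complex.norm_exp]
  calc _ ≤ (η * Real.exp B) * 1 := by
        gcongr
        exact Real.exp_le_one_iff.2 hψ1
    _ = _ := mul_one _

/-! ### Compound Poisson approximation by recoloring -/

section Stein

variable {V : Type*} [DecidableEq V]

/-- The weighted number of monochromatic edges. -/
noncomputable def edgeSum {κ : Type*} (E : Finset (Finset V)) (w : Finset V → ℝ) (x : V → κ) : ℝ :=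
  ∑ e ∈ E, w e * monoInd e x

/-- The edges other than `e` that may be affected by recoloring `e` with the color of `v`. -/
def affected (E : Finset (Finset V)) (e : Finset V) (v : V) : Finset (Finset V) :=
  E.filter fun f => f ≠ e ∧ ¬ Disjoint f (e.erase v)

lemma edgeSum_recolor {κ : Type*} {E : Finset (Finset V)} (w : Finset V → ℝ) {e : Finset V}
    (he : e ∈ E) (v : V) (x : V → κ) (h0 : monoInd e x = 0)
    (h : ∀ f ∈ affected E e v, monoInd f (recolor e v x) = monoInd f x) :
    edgeSum E w (recolor e v x) = w e + edgeSum E w x := by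
  simp only [edgeSum]
  rw [← add_sum_erase E _ he, ← add_sum_erase E (fun f => w f * monoInd f x) he, h0,
    monoInd_recolor_self, mul_one, mul_zero, zero_add]
  congr 1
  refine sum_congr rfl fun f hf => ?_
  rw [mem_erase] at hf
  by_cases hd : Disjoint f (e.erase v)
  · rw [monoInd_recolor_of_disjoint hd]
  · rw [h f (mem_filter.2 ⟨hf.2, hf.1, hd⟩)]

/-- The difference vanishes unless `e` was already monochromatic or some affected edge changes
status. Otherwise it is at most `2`, a difference of unit complex numbers, and the bracket on the
right is at least `1`. -/
lemma norm_exp_edgeSum_recolor_sub_le {κ : Type*} {E : Finset (Finset V)} (w : Finset V → ℝ)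
    {e : Finset V} (he : e ∈ E) (v : V) (x : V → κ) (s : ℝ) :
    ‖Complex.exp ((s * edgeSum E w (recolor e v x) : ℝ) * Complex.I) -
      Complex.exp ((s * w e : ℝ) * Complex.I) *
        Complex.exp ((s * edgeSum E w x : ℝ) * Complex.I)‖ ≤
    2 * (monoInd e x +
      ∑ f ∈ affected E e v, (monoInd f x + monoInd f (recolor e v x))) := by
  have hnn : ∀ f ∈ affected E e v, 0 ≤ monoInd f x + monoInd f (recolor e v x) := fun f _ =>
    add_nonneg (monoInd_nonneg _ _) (monoInd_nonneg _ _)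
  by_cases h : monoInd e x = 0 ∧ ∀ f ∈ affected E e v, monoInd f (recolor e v x) = monoInd f x
  · rw [edgeSum_recolor w he v x h.1 h.2, ← Complex.exp_add, ← add_mul, ← Complex.ofReal_add,
      ← mul_add, sub_self, norm_zero]
    have := sum_nonneg hnn
    have := monoInd_nonneg e x
    positivity
  · have h1 : 1 ≤ monoInd e x +
        ∑ f ∈ affected E e v, (monoInd f x + monoInd f (recolor e v x)) := by
      rw [not_and_or] at h
      obtain h | h := h
      · rw [(monoInd_eq_zero_or_one e x).resolve_left h]
        linarith [sum_nonneg hnn]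
      · push Not at h
        obtain ⟨f, hf, hne⟩ := h
        have h2 := single_le_sum hnn hf
        have h3 := monoInd_nonneg e x
        obtain ha | ha := monoInd_eq_zero_or_one f x <;>
        obtain hb | hb := monoInd_eq_zero_or_one f (recolor e v x) <;>
        rw [ha, hb] at hne h2 <;> first | exact absurd rfl hne | linarith
    refine (norm_sub_le _ _).trans ?_
    rw [norm_mul, Complex.norm_exp_ofReal_mul_I, Complex.norm_exp_ofReal_mul_I,
      Complex.norm_exp_ofReal_mul_I]
    linarith

variable [Fintype V] {c : ℕ}

/-- The coupling error of the edge `e`, when recolored with the color of `v`. -/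
noncomputable def couplingError (c : ℕ) (E : Finset (Finset V)) (r : ℕ) (e : Finset V) (v : V) :
    ℝ :=
  monoProb c r * monoProb c r +
    ∑ f ∈ affected E e v, (monoProb c r * monoProb c r + pairProb c e f)

/-- Averages the pointwise coupling bound. The prefactor `monoProb c r` turns the probability that
`f` is monochromatic after recoloring into `pairProb c e f`, and the other terms into squares. -/
lemma norm_avg_monoInd_smul_exp_sub_le (hc : 0 < c) {E : Finset (Finset V)} {r : ℕ} (hr : 1 ≤ r)
    (hE : ∀ e ∈ E, #e = r) (w : Finset V → ℝ) {e : Finset V} (he : e ∈ E) {v : V} (hv : v ∈ e)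
    (s : ℝ) :
    ‖avg (fun x : V → Fin c => monoInd e x • Complex.exp ((s * edgeSum E w x : ℝ) * Complex.I)) -
      monoProb c r • (Complex.exp ((s * w e : ℝ) * Complex.I) *
        avg (fun x : V → Fin c => Complex.exp ((s * edgeSum E w x : ℝ) * Complex.I)))‖ ≤
    2 * couplingError c E r e v := by
  have hm : ∀ f ∈ E, avg (fun x : V → Fin c => monoInd f x) = monoProb c r := fun f hf => by
    rw [avg_monoInd hc (card_pos.1 (by rw [hE f hf]; omega)), hE f hf]
  rw [avg_monoInd_smul hc hv, ← avg_const_mul, hE e he, ← smul_sub, ← avg_sub, norm_smul,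
    Real.norm_of_nonneg (monoProb_nonneg _ _)]
  have h1 : avg (fun x : V → Fin c => 2 * (monoInd e x +
      ∑ f ∈ affected E e v, (monoInd f x + monoInd f (recolor e v x)))) =
      2 * (monoProb c r + ∑ f ∈ affected E e v,
        (monoProb c r + avg (fun x : V → Fin c => monoInd f (recolor e v x)))) := by
    rw [avg_const_mul, avg_add, avg_sum, hm e he]
    congr 2
    refine sum_congr rfl fun f hf => ?_
    rw [avg_add, hm f (mem_of_mem_filter f hf)]
  calc _ ≤ monoProb c r * avg (fun x : V → Fin c => 2 * (monoInd e x +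
      ∑ f ∈ affected E e v, (monoInd f x + monoInd f (recolor e v x)))) := by
        refine mul_le_mul_of_nonneg_left ((norm_avg_le _).trans (avg_mono fun x => ?_))
          (monoProb_nonneg _ _)
        exact norm_exp_edgeSum_recolor_sub_le w he v x s
    _ = _ := by
        rw [h1, couplingError, mul_left_comm, mul_add, mul_sum]
        simp only [pairProb_eq_mul_recolor hc hv, hE e he, mul_add]

/-- The characteristic function of a weighted number of monochromatic edges is close to that of a
compound Poisson distribution. -/
lemma norm_avg_exp_edgeSum_sub_le (hc : 0 < c) {E : Finset (Finset V)} {r : ℕ} (hr : 1 ≤ r)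
    (hE : ∀ e ∈ E, #e = r) (w : Finset V → ℝ) {W : ℝ} (hW : ∀ e ∈ E, |w e| ≤ W)
    (v : Finset V → V) (hv : ∀ e ∈ E, v e ∈ e) :
    ‖avg (fun x : V → Fin c => Complex.exp ((edgeSum E w x : ℝ) * Complex.I)) -
      Complex.exp (∑ e ∈ E, monoProb c r * (Complex.exp ((w e : ℝ) * Complex.I) - 1))‖ ≤
    (2 * W * ∑ e ∈ E, couplingError c E r e (v e)) * Real.exp (2 * (#E * monoProb c r)) := by
  set p := monoProb c r
  have hp : 0 ≤ p := monoProb_nonneg c r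
  have hexp : ∀ (a s : ℝ), HasDerivAt (fun s : ℝ => Complex.exp ((s * a : ℝ) * Complex.I))
      (a * Complex.I * Complex.exp ((s * a : ℝ) * Complex.I)) s := fun a s => by
    have h1 : HasDerivAt (fun s : ℝ => ((s * a : ℝ) : ℂ) * Complex.I) (a * Complex.I) s := by
      have := (((hasDerivAt_id s).mul_const a).ofReal_comp).mul_const Complex.I
      simpa using this
    convert! h1.cexp using 1
    ring
  have key := norm_sub_exp_le_of_deriv
    (φ := fun s => avg (fun x : V → Fin c => Complex.exp ((s * edgeSum E w x : ℝ) * Complex.I)))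
    (φ' := fun s => ∑ e ∈ E, w e * Complex.I * avg (fun x : V → Fin c =>
      monoInd e x • Complex.exp ((s * edgeSum E w x : ℝ) * Complex.I)))
    (ψ := fun s => ∑ e ∈ E, p * (Complex.exp ((s * w e : ℝ) * Complex.I) - 1))
    (ψ' := fun s => ∑ e ∈ E, p * (w e * Complex.I * Complex.exp ((s * w e : ℝ) * Complex.I)))
    -- `B` comes from `cos θ - 1 ≥ -2` for each edge.
    (η := 2 * W * ∑ e ∈ E, couplingError c E r e (v e)) (B := 2 * (#E * p))
    ?_ ?_ ?_ ?_ ?_ ?_ ?_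
  · simpa using key
  · intro s
    have h1 : HasDerivAt (fun s : ℝ => ∑ x : V → Fin c,
        Complex.exp ((s * edgeSum E w x : ℝ) * Complex.I)) (∑ x : V → Fin c,
        (edgeSum E w x * Complex.I * Complex.exp ((s * edgeSum E w x : ℝ) * Complex.I))) s :=
      HasDerivAt.fun_sum fun x _ => hexp (edgeSum E w x) s
    have h2 := h1.const_smul (((c : ℝ) ^ Fintype.card V)⁻¹)
    convert! h2 using 1
    simp only [← avg_const_mul]
    rw [← avg_sum, avg]
    congr 1
    refine sum_congr rfl fun x _ => ?_
    simp only [edgeSum, Complex.ofReal_sum, sum_mul, Complex.real_smul, Complex.ofReal_mul]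
    refine sum_congr rfl fun e _ => ?_
    ring
  · intro s
    exact HasDerivAt.fun_sum fun e _ => ((hexp (w e) s).sub_const 1).const_mul _
  · simp [avg_const hc]
  · simp
  · rw [Complex.re_sum]
    refine sum_nonpos fun e _ => ?_
    rw [Complex.re_ofReal_mul, Complex.sub_re, Complex.exp_ofReal_mul_I_re, Complex.one_re]
    have := Real.cos_le_one (1 * w e)
    exact mul_nonpos_of_nonneg_of_nonpos hp (by linarith)
  · intro s
    rw [Complex.re_sum]
    calc -(2 * (#E * p)) = ∑ e ∈ E, p * (-2) := by
          rw [sum_const, nsmul_eq_mul]; ring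
      _ ≤ _ := by
          refine sum_le_sum fun e _ => ?_
          rw [Complex.re_ofReal_mul, Complex.sub_re, Complex.exp_ofReal_mul_I_re, Complex.one_re]
          have := Real.neg_one_le_cos (s * w e)
          exact mul_le_mul_of_nonneg_left (by linarith) hp
  · intro s
    rw [sum_mul, ← sum_sub_distrib, mul_sum]
    refine (norm_sum_le _ _).trans (sum_le_sum fun e he => ?_)
    have h1 := norm_avg_monoInd_smul_exp_sub_le hc hr hE w he (hv e he) s
    have h2 := hW e he
    have : ∀ a b d g : ℂ, g * Complex.I * a - p * (g * Complex.I * b) * d =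
        g * Complex.I * (a - p • (b * d)) := fun a b d g => by
      rw [Complex.real_smul]; ring
    rw [this, norm_mul, norm_mul, Complex.norm_I, mul_one, Complex.norm_real, Real.norm_eq_abs]
    calc _ ≤ W * (2 * couplingError c E r e (v e)) := by gcongr; exact (abs_nonneg _).trans h2
      _ = _ := by ring

end Stein

/-! ### Degrees, codegrees and overlapping pairs -/

section Overlaps

variable {V : Type*} [DecidableEq V]

/-- The number of edges containing all the vertices of `S`. -/
def codegree (E : Finset (Finset V)) (S : Finset V) : ℕ := #{e ∈ E | S ⊆ e}

lemma codegree_union_le (E F : Finset (Finset V)) (S : Finset V) :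
    codegree (E ∪ F) S ≤ codegree E S + codegree F S := by
  rw [codegree, filter_union]
  exact card_union_le _ _

lemma card_affected_le (E : Finset (Finset V)) (e : Finset V) (v : V) :
    #(affected E e v) ≤ ∑ u ∈ e.erase v, codegree E {u} := by
  have : affected E e v ⊆ (e.erase v).biUnion fun u => {f ∈ E | {u} ⊆ f} := by
    intro f hf
    obtain ⟨hfE, -, hd⟩ := mem_filter.1 hf
    obtain ⟨u, huf, hue⟩ := not_disjoint_iff.1 hd
    exact mem_biUnion.2 ⟨u, hue, mem_filter.2 ⟨hfE, singleton_subset_iff.2 huf⟩⟩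
  exact (card_le_card this).trans card_biUnion_le

variable [Fintype V] {c : ℕ}

/-- The sum of the joint probabilities over the pairs of distinct edges that share at least two
vertices. -/
noncomputable def overlap (c : ℕ) (E : Finset (Finset V)) : ℝ :=
  ∑ e ∈ E, ∑ f ∈ E with f ≠ e ∧ 2 ≤ #(e ∩ f), pairProb c e f

lemma overlap_nonneg (E : Finset (Finset V)) : 0 ≤ overlap c E :=
  sum_nonneg fun _ _ => sum_nonneg fun _ _ => pairProb_nonneg _ _

/-- Affected edges sharing one vertex with `e` cost `2p²` each by independence, and their number is
bounded by degrees; those sharing more are absorbed in `overlap`. -/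
lemma sum_couplingError_le (hc : 0 < c) {E : Finset (Finset V)} {r : ℕ} (hr : 1 ≤ r)
    (hE : ∀ e ∈ E, #e = r) (v : Finset V → V) :
    ∑ e ∈ E, couplingError c E r e (v e) ≤ #E * (monoProb c r * monoProb c r) +
      2 * overlap c E +
      2 * (monoProb c r * monoProb c r) * ∑ e ∈ E, ∑ u ∈ e.erase (v e), (codegree E {u} : ℝ) := by
  set p := monoProb c r
  have h : ∀ e ∈ E, couplingError c E r e (v e) ≤ p * p +
      2 * (∑ f ∈ E with f ≠ e ∧ 2 ≤ #(e ∩ f), pairProb c e f) +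
      2 * (p * p) * ∑ u ∈ e.erase (v e), (codegree E {u} : ℝ) := by
    intro e he
    have h1 : ∑ f ∈ affected E e (v e), (p * p + pairProb c e f) ≤
        ∑ f ∈ affected E e (v e),
          (2 * (p * p) + if 2 ≤ #(e ∩ f) then 2 * pairProb c e f else 0) := by
      refine sum_le_sum fun f hf => ?_
      have hfE := hE f (mem_of_mem_filter f hf)
      split_ifs with h2
      · have := pairProb_nonneg (c := c) e f
        have := mul_self_nonneg p
        linarith
      · rw [pairProb_of_card_inter_le_one hc hr (hE e he) hfE (by omega)]
        linarith
    have h2 : ∑ f ∈ affected E e (v e), (if 2 ≤ #(e ∩ f) then 2 * pairProb c e f else 0) ≤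
        2 * ∑ f ∈ E with f ≠ e ∧ 2 ≤ #(e ∩ f), pairProb c e f := by
      rw [← sum_filter, mul_sum]
      refine sum_le_sum_of_subset_of_nonneg (fun f hf => ?_)
        fun f _ _ => mul_nonneg zero_le_two (pairProb_nonneg _ _)
      simp only [affected, mem_filter] at hf ⊢
      exact ⟨hf.1.1, hf.1.2.1, hf.2⟩
    have h3 : (#(affected E e (v e)) : ℝ) ≤ ∑ u ∈ e.erase (v e), (codegree E {u} : ℝ) := by
      exact_mod_cast card_affected_le E e (v e)
    have h1 := h1.trans_eq (by rw [sum_add_distrib, sum_const, nsmul_eq_mul])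
    have h4 := mul_le_mul_of_nonneg_left h3 (mul_nonneg zero_le_two (mul_self_nonneg p))
    change p * p + ∑ f ∈ affected E e (v e), (p * p + pairProb c e f) ≤ _
    linarith
  refine (sum_le_sum h).trans (le_of_eq ?_)
  rw [sum_add_distrib, sum_add_distrib, sum_const, nsmul_eq_mul, ← mul_sum, ← mul_sum, overlap]

/-- The number of ordered pairs of edges sharing at least two vertices. -/
noncomputable def overlapCount (E : Finset (Finset V)) : ℝ :=
  ∑ e ∈ E, ∑ f ∈ E, if 2 ≤ #(e ∩ f) then 1 else 0

lemma sum_codegree_singleton {E : Finset (Finset V)} {r : ℕ} (hE : ∀ e ∈ E, #e = r) :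
    ∑ u, (codegree E {u} : ℝ) = r * #E := by
  simp only [codegree, card_filter, singleton_subset_iff, Nat.cast_sum]
  rw [sum_comm, sum_congr rfl (g := fun _ => (r : ℝ)), sum_const, nsmul_eq_mul, mul_comm]
  intro e he
  rw [← Nat.cast_sum, sum_boole, ← hE e he]
  simp

/-- Double counting: two edges `e`, `f` contribute one term for each ordered pair of distinct
vertices in `e ∩ f`, hence at most `r ^ 2`, and none when `#(e ∩ f) ≤ 1`. -/
lemma sum_sq_card_offDiag_le {E : Finset (Finset V)} {r : ℕ} (hE : ∀ e ∈ E, #e = r) :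
    ∑ a : V × V, (#{e ∈ E | a ∈ e.offDiag} : ℝ) ^ 2 ≤ (r : ℝ) ^ 2 * overlapCount E := by
  have h1 : ∀ a : V × V, (#{e ∈ E | a ∈ e.offDiag} : ℝ) ^ 2 =
      ∑ e ∈ E, ∑ f ∈ E, if a ∈ (e ∩ f).offDiag then 1 else 0 := fun a => by
    rw [sq, card_filter, Nat.cast_sum, sum_mul_sum]
    refine sum_congr rfl fun e _ => sum_congr rfl fun f _ => ?_
    simp only [mem_offDiag, mem_inter]
    split_ifs <;> simp_all
  simp only [h1]
  rw [sum_comm, overlapCount, mul_sum]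
  refine sum_le_sum fun e he => ?_
  rw [sum_comm, mul_sum]
  refine sum_le_sum fun f _ => ?_
  rw [sum_boole, filter_mem_eq_inter, univ_inter, offDiag_card]
  have h2 : #(e ∩ f) ≤ r := hE e he ▸ card_le_card inter_subset_left
  split_ifs with h
  · rw [mul_one]
    have : #(e ∩ f) * #(e ∩ f) - #(e ∩ f) ≤ r ^ 2 :=
      (Nat.sub_le _ _).trans (by rw [sq]; exact Nat.mul_le_mul h2 h2)
    exact_mod_cast this
  · have : #(e ∩ f) * #(e ∩ f) - #(e ∩ f) = 0 := by
      have : #(e ∩ f) = 0 ∨ #(e ∩ f) = 1 := by omega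
      obtain h | h := this <;> simp [h]
    simp [this]

/-- The sum over the edges of the vertex degrees other than the largest one. -/
lemma sum_codegree_erase_le {E : Finset (Finset V)} {r : ℕ} (hE : ∀ e ∈ E, #e = r)
    (v : Finset V → V) (hv : ∀ e ∈ E, v e ∈ e)
    (hmax : ∀ e ∈ E, ∀ u ∈ e, codegree E {u} ≤ codegree E {v e}) :
    ∑ e ∈ E, ∑ u ∈ e.erase (v e), (codegree E {u} : ℝ) ≤
      (r : ℝ) ^ 2 * #E * √(overlapCount E) := by
  set g : V → ℝ := fun u => √(codegree E {u})
  have hg : ∀ u, g u * g u = codegree E {u} := fun u => Real.mul_self_sqrt (Nat.cast_nonneg _)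
  have hg0 : ∀ u, 0 ≤ g u := fun u => Real.sqrt_nonneg _
  have h1 : ∀ e ∈ E, ∑ u ∈ e.erase (v e), (codegree E {u} : ℝ) ≤
      ∑ a ∈ e.offDiag, g a.1 * g a.2 := by
    intro e he
    -- Maximality of `v e` gives `deg u ≤ √(deg u * deg (v e))`, a term symmetric in the two
    -- vertices, ready for Cauchy–Schwarz over vertex pairs.
    calc _ ≤ ∑ u ∈ e.erase (v e), g u * g (v e) := by
          refine sum_le_sum fun u hu => ?_
          rw [← hg]
          refine mul_le_mul_of_nonneg_left (Real.sqrt_le_sqrt ?_) (hg0 u)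
          exact_mod_cast hmax e he u (mem_of_mem_erase hu)
      _ = ∑ a ∈ (e.erase (v e)).image fun u => (u, v e), g a.1 * g a.2 := by
          rw [sum_image fun a _ b _ h => (Prod.ext_iff.1 h).1]
      _ ≤ _ := by
          refine sum_le_sum_of_subset_of_nonneg (fun a ha => ?_)
            fun a _ _ => mul_nonneg (hg0 _) (hg0 _)
          obtain ⟨u, hu, rfl⟩ := mem_image.1 ha
          rw [mem_erase] at hu
          exact mem_offDiag.2 ⟨hu.2, hv e he, hu.1⟩
  have h2 : ∑ e ∈ E, ∑ a ∈ e.offDiag, g a.1 * g a.2 =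
      ∑ a : V × V, (#{e ∈ E | a ∈ e.offDiag} : ℝ) * (g a.1 * g a.2) := by
    simp only [card_filter, Nat.cast_sum, sum_mul]
    rw [sum_comm]
    refine sum_congr rfl fun e _ => ?_
    simp only [Nat.cast_ite, Nat.cast_one, Nat.cast_zero, ite_mul, one_mul, zero_mul]
    rw [sum_ite_mem, univ_inter]
  have h3 : ∑ a : V × V, (g a.1 * g a.2) ^ 2 = (r * #E : ℝ) ^ 2 := by
    rw [← sum_codegree_singleton hE, sq, sum_mul_sum, Fintype.sum_prod_type]
    refine sum_congr rfl fun a _ => sum_congr rfl fun b _ => ?_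
    rw [← hg a, ← hg b]; ring
  calc _ ≤ ∑ e ∈ E, ∑ a ∈ e.offDiag, g a.1 * g a.2 := sum_le_sum h1
    _ ≤ √(∑ a : V × V, (#{e ∈ E | a ∈ e.offDiag} : ℝ) ^ 2) *
        √(∑ a : V × V, (g a.1 * g a.2) ^ 2) := by
        rw [h2]; exact Real.sum_mul_le_sqrt_mul_sqrt _ _ _
    _ ≤ √((r : ℝ) ^ 2 * overlapCount E) * (r * #E) := by
        rw [h3, Real.sqrt_sq (by positivity)]
        gcongr
        exact sum_sq_card_offDiag_le hE
    _ = _ := by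
        rw [Real.sqrt_mul (by positivity), Real.sqrt_sq (by positivity)]; ring

lemma sq_monoProb_mul_overlapCount_le (hc : 0 < c) {E : Finset (Finset V)} {r : ℕ} (hr : 1 ≤ r)
    (hE : ∀ e ∈ E, #e = r) :
    monoProb c r * monoProb c r * overlapCount E ≤
      #E * (monoProb c r * monoProb c r) + overlap c E := by
  rw [overlapCount, overlap, mul_sum, ← nsmul_eq_mul, ← sum_const, ← sum_add_distrib]
  refine sum_le_sum fun e he => ?_
  rw [mul_sum, sum_filter]
  have : monoProb c r * monoProb c r =
      ∑ f ∈ E, if f = e then monoProb c r * monoProb c r else 0 := by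
    rw [sum_ite_eq' E e, if_pos he]
  nth_rw 2 [this]
  rw [← sum_add_distrib]
  refine sum_le_sum fun f hf => ?_
  have h1 := sq_monoProb_le_pairProb hc hr (hE e he) (hE f hf)
  have h2 := mul_self_nonneg (monoProb c r)
  by_cases hfe : f = e
  · simp only [hfe, if_true, ne_eq, not_true, false_and, if_false, add_zero]
    split_ifs <;> simp [h2]
  · simp only [hfe, ne_eq, not_false_iff, true_and, if_false, zero_add]
    split_ifs <;> simp [h1]

/-- Choosing the vertex of largest degree of each edge makes the total coupling error small. -/
lemma exists_sum_couplingError_le (hc : 0 < c) {E : Finset (Finset V)} {r : ℕ} (hr : 1 ≤ r)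
    (hE : ∀ e ∈ E, #e = r) [Nonempty V] :
    ∃ v : Finset V → V, (∀ e ∈ E, v e ∈ e) ∧
      ∑ e ∈ E, couplingError c E r e (v e) ≤
        #E * monoProb c r * monoProb c r + 2 * overlap c E + 2 * r ^ 2 * (#E * monoProb c r) *
          √(#E * monoProb c r * monoProb c r + overlap c E) := by
  have : ∀ e : Finset V, ∃ v : V, e ∈ E → v ∈ e ∧ ∀ u ∈ e, codegree E {u} ≤ codegree E {v} := by
    intro e
    by_cases he : e ∈ E
    · obtain ⟨v, hv, h⟩ := exists_max_image e (fun u => codegree E {u})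
        (card_pos.1 (by rw [hE e he]; omega))
      exact ⟨v, fun _ => ⟨hv, h⟩⟩
    · exact ⟨Classical.arbitrary V, fun h => absurd h he⟩
  choose v hv using this
  refine ⟨v, fun e he => (hv e he).1, (sum_couplingError_le hc hr hE v).trans ?_⟩
  have h1 := sum_codegree_erase_le hE v (fun e he => (hv e he).1) (fun e he => (hv e he).2)
  have h2 := sq_monoProb_mul_overlapCount_le hc hr hE
  set p := monoProb c r
  have hp : 0 ≤ p := monoProb_nonneg c r
  have h3 : p * √(overlapCount E) ≤ √(#E * p * p + overlap c E) := by
    rw [mul_assoc (#E : ℝ)]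
    refine le_trans ?_ (Real.sqrt_le_sqrt h2)
    rw [Real.sqrt_mul (by positivity), Real.sqrt_mul_self hp]
  have h4 : 2 * (p * p) * ∑ e ∈ E, ∑ u ∈ e.erase (v e), (codegree E {u} : ℝ) ≤
      2 * r ^ 2 * (#E * p) * √(#E * p * p + overlap c E) := by
    calc _ ≤ 2 * (p * p) * ((r : ℝ) ^ 2 * #E * √(overlapCount E)) := by gcongr
      _ = 2 * r ^ 2 * (#E * p) * (p * √(overlapCount E)) := by ring
      _ ≤ _ := by gcongr
  rw [mul_assoc (#E : ℝ)] at *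
  linarith

/-- The sum over the vertex sets of size between `2` and `r - 1` of the squared codegrees, weighted
by the probability that two edges meeting in that set are both monochromatic. -/
noncomputable def codegreeEnergy (c r : ℕ) (E : Finset (Finset V)) : ℝ :=
  ∑ S : Finset V with 2 ≤ #S ∧ #S < r, monoProb c (2 * r - #S) * (codegree E S : ℝ) ^ 2

/-- This is the purpose of the energy: being a sum of squares of subadditive codegrees, it controls
cross pairs by the two layers separately. -/
lemma codegreeEnergy_union_le (r : ℕ) (E F : Finset (Finset V)) :
    codegreeEnergy c r (E ∪ F) ≤ 2 * (codegreeEnergy c r E + codegreeEnergy c r F) := by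
  simp only [codegreeEnergy, ← sum_add_distrib, mul_sum]
  refine sum_le_sum fun S _ => ?_
  have h1 : (codegree (E ∪ F) S : ℝ) ≤ codegree E S + codegree F S := by
    exact_mod_cast codegree_union_le E F S
  calc _ ≤ monoProb c (2 * r - #S) * (codegree E S + codegree F S : ℝ) ^ 2 := by
        gcongr; exact monoProb_nonneg _ _
    _ ≤ monoProb c (2 * r - #S) * (2 * ((codegree E S : ℝ) ^ 2 + (codegree F S : ℝ) ^ 2)) := by
        refine mul_le_mul_of_nonneg_left ?_ (monoProb_nonneg _ _)
        nlinarith [sq_nonneg ((codegree E S : ℝ) - codegree F S)]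
    _ = _ := by ring

lemma codegreeEnergy_eq (r : ℕ) (E : Finset (Finset V)) :
    codegreeEnergy c r E = ∑ e ∈ E, ∑ f ∈ E,
      ∑ S : Finset V with (2 ≤ #S ∧ #S < r) ∧ S ⊆ e ∩ f, monoProb c (2 * r - #S) := by
  have h : ∀ S : Finset V, (codegree E S : ℝ) ^ 2 =
      ∑ e ∈ E, ∑ f ∈ E, if S ⊆ e ∩ f then 1 else 0 := fun S => by
    rw [sq, codegree, card_filter, Nat.cast_sum, sum_mul_sum]
    refine sum_congr rfl fun e _ => sum_congr rfl fun f _ => ?_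
    simp only [subset_inter_iff]
    split_ifs <;> simp_all
  simp only [codegreeEnergy, h, mul_sum]
  rw [sum_comm]
  refine sum_congr rfl fun e _ => ?_
  rw [sum_comm]
  refine sum_congr rfl fun f _ => ?_
  simp only [mul_ite, mul_one, mul_zero]
  rw [← sum_filter, filter_filter]

lemma overlap_le_codegreeEnergy (hc : 0 < c) {E : Finset (Finset V)} {r : ℕ}
    (hE : ∀ e ∈ E, #e = r) : overlap c E ≤ codegreeEnergy c r E := by
  rw [codegreeEnergy_eq, overlap]
  refine sum_le_sum fun e he => ?_
  rw [sum_filter]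
  refine sum_le_sum fun f hf => ?_
  have hnn : ∀ S ∈ ({S : Finset V | (2 ≤ #S ∧ #S < r) ∧ S ⊆ e ∩ f} : Finset _),
      0 ≤ monoProb c (2 * r - #S) := fun S _ => monoProb_nonneg _ _
  split_ifs with h
  · rw [pairProb_of_inter_nonempty hc (hE e he) (hE f hf) (card_pos.1 (by omega))]
    -- The term `S = e ∩ f` alone suffices; it has fewer than `r` elements because `e ≠ f`.
    refine single_le_sum (f := fun S => monoProb c (2 * r - #S)) hnn ?_
    refine mem_filter.2 ⟨mem_univ _, ⟨h.2, ?_⟩, Subset.rfl⟩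
    by_contra hlt
    have h1 : e ∩ f = e := eq_of_subset_of_card_le inter_subset_left (by rw [hE e he]; omega)
    have h2 : e ∩ f = f := eq_of_subset_of_card_le inter_subset_right (by rw [hE f hf]; omega)
    exact h.1 (h2.symm.trans h1)
  · exact sum_nonneg hnn

lemma codegreeEnergy_le (hc : 0 < c) {E : Finset (Finset V)} {r : ℕ} (hE : ∀ e ∈ E, #e = r) :
    codegreeEnergy c r E ≤ 2 ^ r * (overlap c E + #E * monoProb c (r + 1)) := by
  rw [codegreeEnergy_eq, overlap, ← nsmul_eq_mul, ← sum_const, ← sum_add_distrib, mul_sum]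
  refine sum_le_sum fun e he => ?_
  have : monoProb c (r + 1) = ∑ f ∈ E, if f = e then monoProb c (r + 1) else 0 := by
    rw [sum_ite_eq' E e, if_pos he]
  rw [this, sum_filter, ← sum_add_distrib, mul_sum]
  refine sum_le_sum fun f hf => ?_
  have hcard : #(e ∩ f) ≤ r := hE e he ▸ card_le_card inter_subset_left
  have hsets : (#({S : Finset V | (2 ≤ #S ∧ #S < r) ∧ S ⊆ e ∩ f} : Finset _) : ℝ) ≤ 2 ^ r := by
    have h1 : ({S : Finset V | (2 ≤ #S ∧ #S < r) ∧ S ⊆ e ∩ f} : Finset _) ⊆ (e ∩ f).powerset :=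
      fun S hS => mem_powerset.2 (mem_filter.1 hS).2.2
    have h2 := card_le_card h1
    rw [card_powerset] at h2
    exact_mod_cast h2.trans (Nat.pow_le_pow_right two_pos hcard)
  have hbound : ∀ b : ℝ, 0 ≤ b → (∀ S : Finset V, 2 ≤ #S → #S < r → S ⊆ e ∩ f →
      monoProb c (2 * r - #S) ≤ b) →
      ∑ S : Finset V with (2 ≤ #S ∧ #S < r) ∧ S ⊆ e ∩ f, monoProb c (2 * r - #S) ≤ 2 ^ r * b := by
    intro b hb h
    refine (sum_le_card_nsmul _ _ b fun S hS => ?_).trans ?_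
    · obtain ⟨-, ⟨h1, h2⟩, h3⟩ := mem_filter.1 hS
      exact h S h1 h2 h3
    · rw [nsmul_eq_mul]
      gcongr
  apply hbound
  · have h1 := monoProb_nonneg c (r + 1)
    have h2 := pairProb_nonneg (c := c) e f
    split_ifs <;> linarith
  · intro S h1 h2 h3
    -- On the diagonal `#S < r` gives `2r - #S ≥ r + 1`, which gains a factor `1 / c` over `monoProb
    -- c r`. Off it, `S ⊆ e ∩ f` gives a bound by `pairProb`.
    by_cases hfe : f = e
    · simpa [hfe] using monoProb_anti hc (by omega)
    · have h4 := h1.trans (card_le_card h3)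
      rw [if_pos ⟨hfe, h4⟩, if_neg hfe, add_zero,
        pairProb_of_inter_nonempty hc (hE e he) (hE f hf) (card_pos.1 (by omega))]
      have := card_le_card h3
      exact monoProb_anti hc (by omega)

end Overlaps

/-! ### Covariances and the explicit error bound -/

section Covariances

variable {V : Type*} [Fintype V] [DecidableEq V] {c : ℕ}

/-- The covariance of the numbers of monochromatic edges in two `r`-uniform edge sets. -/
noncomputable def edgeCov (c r : ℕ) (E F : Finset (Finset V)) : ℝ :=
  ∑ e ∈ E, ∑ f ∈ F, (pairProb c e f - monoProb c r * monoProb c r)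

/-- The contribution of the pairs of distinct edges to the covariance. -/
noncomputable def offDiagCov (c r : ℕ) (E F : Finset (Finset V)) : ℝ :=
  ∑ e ∈ E, ∑ f ∈ F with f ≠ e, (pairProb c e f - monoProb c r * monoProb c r)

variable {r : ℕ} {E F : Finset (Finset V)}

lemma avg_sum_monoInd (hc : 0 < c) (hr : 1 ≤ r) (hE : ∀ e ∈ E, #e = r) :
    avg (fun x : V → Fin c => ∑ e ∈ E, monoInd e x) = #E * monoProb c r := by
  rw [avg_sum, ← nsmul_eq_mul, ← sum_const]
  refine sum_congr rfl fun e he => ?_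
  rw [avg_monoInd hc (card_pos.1 (by rw [hE e he]; omega)), hE e he]

lemma avg_sub_mul_sub (hc : 0 < c) (hr : 1 ≤ r) (hE : ∀ e ∈ E, #e = r) (hF : ∀ e ∈ F, #e = r) :
    avg (fun x : V → Fin c => (∑ e ∈ E, monoInd e x - #E * monoProb c r) *
      (∑ f ∈ F, monoInd f x - #F * monoProb c r)) = edgeCov c r E F := by
  have h1 : ∀ x : V → Fin c, (∑ e ∈ E, monoInd e x - #E * monoProb c r) *
      (∑ f ∈ F, monoInd f x - #F * monoProb c r) =
      ∑ e ∈ E, ∑ f ∈ F, monoInd e x * monoInd f x - (#F * monoProb c r * ∑ e ∈ E, monoInd e x +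
        (#E * monoProb c r * ∑ f ∈ F, monoInd f x - #E * monoProb c r * (#F * monoProb c r))) :=
    fun x => by rw [← sum_mul_sum]; ring
  simp only [h1]
  rw [avg_sub, avg_add, avg_sub, avg_const hc, avg_const_mul, avg_const_mul,
    avg_sum_monoInd hc hr hE, avg_sum_monoInd hc hr hF, avg_sum, edgeCov]
  simp only [sum_sub_distrib, sum_const, nsmul_eq_mul]
  rw [sum_congr rfl fun e _ => avg_sum F fun f (x : V → Fin c) => monoInd e x * monoInd f x]
  simp only [pairProb]
  ring

lemma edgeCov_eq (hc : 0 < c) (hr : 1 ≤ r) (hE : ∀ e ∈ E, #e = r) :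
    edgeCov c r E F = #(E ∩ F) * (monoProb c r - monoProb c r * monoProb c r) +
      offDiagCov c r E F := by
  rw [edgeCov, offDiagCov, ← nsmul_eq_mul, ← sum_const, ← filter_mem_eq_inter, sum_filter,
    ← sum_add_distrib]
  refine sum_congr rfl fun e he => ?_
  rw [← sum_filter_add_sum_filter_not F (fun f => f = e), filter_eq']
  congr 1
  split_ifs
  · rw [sum_singleton, pairProb_self hc (card_pos.1 (by rw [hE e he]; omega)), hE e he]
  · rfl

lemma offDiagCov_nonneg (hc : 0 < c) (hr : 1 ≤ r) (hE : ∀ e ∈ E, #e = r) (hF : ∀ e ∈ F, #e = r) :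
    0 ≤ offDiagCov c r E F :=
  sum_nonneg fun e he => sum_nonneg fun f hf =>
    sub_nonneg.2 (sq_monoProb_le_pairProb hc hr (hE e he) (hF f (mem_of_mem_filter f hf)))

lemma offDiagCov_le_overlap (hc : 0 < c) (hr : 1 ≤ r) (hE : ∀ e ∈ E, #e = r)
    (hF : ∀ e ∈ F, #e = r) : offDiagCov c r E F ≤ overlap c (E ∪ F) := by
  rw [offDiagCov, overlap]
  refine (sum_le_sum fun e he => ?_).trans (sum_le_sum_of_subset_of_nonneg subset_union_left
    fun _ _ _ => sum_nonneg fun _ _ => pairProb_nonneg _ _)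
  calc _ ≤ ∑ f ∈ F with f ≠ e, if 2 ≤ #(e ∩ f) then pairProb c e f else 0 := by
        refine sum_le_sum fun f hf => ?_
        split_ifs with h
        · linarith [mul_self_nonneg (monoProb c r)]
        · rw [pairProb_of_card_inter_le_one hc hr (hE e he) (hF f (mem_of_mem_filter f hf))
            (by omega), sub_self]
    _ ≤ _ := by
        rw [← sum_filter, filter_filter]
        exact sum_le_sum_of_subset_of_nonneg (filter_subset_filter _ subset_union_right)
          fun _ _ _ => pairProb_nonneg _ _

/-- For two common vertices `p² ≤ pairProb / c ≤ pairProb / 2`, so the covariance is at least half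
of the joint probability; all other covariances are nonnegative. -/
lemma overlap_le_two_mul_offDiagCov (hc : 2 ≤ c) (hr : 1 ≤ r) (hE : ∀ e ∈ E, #e = r) :
    overlap c E ≤ 2 * offDiagCov c r E E := by
  have hc0 : 0 < c := by omega
  have hc2 : (2 : ℝ) ≤ c := by exact_mod_cast hc
  rw [offDiagCov, overlap, mul_sum]
  refine sum_le_sum fun e he => ?_
  rw [mul_sum, ← filter_filter, sum_filter (fun f => 2 ≤ #(e ∩ f))]
  refine sum_le_sum fun f hf => ?_
  have hfE := hE f (mem_of_mem_filter f hf)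
  split_ifs with h
  · have h1 := mul_sq_monoProb_le_pairProb hc0 hr (hE e he) hfE h
    nlinarith [mul_self_nonneg (monoProb c r)]
  · linarith [sq_monoProb_le_pairProb hc0 hr (hE e he) hfE]

/-- The explicit Poisson approximation bound for weighted numbers of monochromatic edges. -/
lemma norm_avg_exp_edgeSum_sub_le_overlap (hc : 0 < c) (hr : 1 ≤ r) (hE : ∀ e ∈ E, #e = r)
    (w : Finset V → ℝ) {W : ℝ} (hW0 : 0 ≤ W) (hW : ∀ e ∈ E, |w e| ≤ W) :
    ‖avg (fun x : V → Fin c => Complex.exp ((edgeSum E w x : ℝ) * Complex.I)) -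
      Complex.exp (∑ e ∈ E, monoProb c r * (Complex.exp ((w e : ℝ) * Complex.I) - 1))‖ ≤
    (2 * W * (#E * monoProb c r * monoProb c r + 2 * overlap c E +
      2 * r ^ 2 * (#E * monoProb c r) * √(#E * monoProb c r * monoProb c r + overlap c E))) *
      Real.exp (2 * (#E * monoProb c r)) := by
  have hp := monoProb_nonneg c r
  have ho := overlap_nonneg (c := c) E
  -- Without edges `V` may be empty, so that no choice of vertices exists.
  obtain rfl | ⟨e, he⟩ := E.eq_empty_or_nonempty
  · simp only [edgeSum, sum_empty, Complex.ofReal_zero, zero_mul, Complex.exp_zero, avg_const hc,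
      sub_self, norm_zero]
    positivity
  · obtain ⟨u, -⟩ : e.Nonempty := card_pos.1 (by rw [hE e he]; omega)
    have : Nonempty V := ⟨u⟩
    obtain ⟨v, hv, hle⟩ := exists_sum_couplingError_le hc hr hE
    refine (norm_avg_exp_edgeSum_sub_le hc hr hE w hW v hv).trans ?_
    gcongr

end Covariances

/-! ### Passage to the limit -/

section Limit

lemma tendsto_monoProb {c : ℕ → ℕ} (hc : Tendsto c atTop atTop) {r : ℕ} (hr : 2 ≤ r) :
    Tendsto (fun n => monoProb (c n) r) atTop (𝓝 0) := by
  have h : Tendsto (fun n => ((c n : ℝ))⁻¹) atTop (𝓝 0) :=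
    tendsto_inv_atTop_zero.comp (tendsto_natCast_atTop_atTop.comp hc)
  refine tendsto_of_tendsto_of_tendsto_of_le_of_le' tendsto_const_nhds h
    (.of_forall fun n => monoProb_nonneg _ _) ?_
  filter_upwards [hc.eventually_ge_atTop 1] with n hn
  simpa [monoProb] using monoProb_anti hn hr

variable {V : ℕ → Type*} [∀ n, Fintype (V n)] [∀ n, DecidableEq (V n)] {r : ℕ} {c : ℕ → ℕ}
  {E F : ∀ n, Finset (Finset (V n))} {a b d : ℝ}

/-- The variance is the mean minus `#E * p²` plus the off-diagonal covariance. Since `p → 0`, equal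
limits force the latter to vanish. -/
lemma tendsto_overlap (hr : 2 ≤ r) (hc : Tendsto c atTop atTop) (hE : ∀ n, ∀ e ∈ E n, #e = r)
    (hmean : Tendsto (fun n => #(E n) * monoProb (c n) r) atTop (𝓝 a))
    (hvar : Tendsto (fun n => edgeCov (c n) r (E n) (E n)) atTop (𝓝 a)) :
    Tendsto (fun n => overlap (c n) (E n)) atTop (𝓝 0) := by
  have hp := tendsto_monoProb hc hr
  have h : Tendsto (fun n => 2 * (edgeCov (c n) r (E n) (E n) -
      (#(E n) * monoProb (c n) r - #(E n) * monoProb (c n) r * monoProb (c n) r))) atTop (𝓝 0) := by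
    simpa using (hvar.sub (hmean.sub (hmean.mul hp))).const_mul 2
  refine tendsto_of_tendsto_of_tendsto_of_le_of_le' tendsto_const_nhds h
    (.of_forall fun n => overlap_nonneg _) ?_
  filter_upwards [hc.eventually_ge_atTop 2] with n hn
  refine (overlap_le_two_mul_offDiagCov hn (by omega) (hE n)).trans (le_of_eq ?_)
  rw [edgeCov_eq (by omega) (by omega) (hE n), inter_self]
  ring

lemma tendsto_codegreeEnergy (hr : 2 ≤ r) (hc : Tendsto c atTop atTop)
    (hE : ∀ n, ∀ e ∈ E n, #e = r)
    (hmean : Tendsto (fun n => #(E n) * monoProb (c n) r) atTop (𝓝 a))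
    (hvar : Tendsto (fun n => edgeCov (c n) r (E n) (E n)) atTop (𝓝 a)) :
    Tendsto (fun n => codegreeEnergy (c n) r (E n)) atTop (𝓝 0) := by
  have h1 : Tendsto (fun n => ((c n : ℝ))⁻¹) atTop (𝓝 0) :=
    tendsto_inv_atTop_zero.comp (tendsto_natCast_atTop_atTop.comp hc)
  have h : Tendsto (fun n => 2 ^ r * (overlap (c n) (E n) +
      #(E n) * monoProb (c n) r * (c n : ℝ)⁻¹)) atTop (𝓝 0) := by
    simpa using ((tendsto_overlap hr hc hE hmean hvar).add (hmean.mul h1)).const_mul (2 ^ r)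
  refine tendsto_of_tendsto_of_tendsto_of_le_of_le' tendsto_const_nhds h
    (.of_forall fun n => sum_nonneg fun S _ => mul_nonneg (monoProb_nonneg _ _) (sq_nonneg _)) ?_
  filter_upwards [hc.eventually_ge_atTop 1] with n hn
  have hcn : (c n : ℝ) ≠ 0 := by positivity
  refine (codegreeEnergy_le hn (hE n)).trans (le_of_eq ?_)
  rw [← mul_monoProb_succ hn (show 1 ≤ r by omega)]
  field_simp

lemma tendsto_overlap_union (hr : 2 ≤ r) (hc : Tendsto c atTop atTop)
    (hE : ∀ n, ∀ e ∈ E n, #e = r) (hF : ∀ n, ∀ e ∈ F n, #e = r)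
    (hmeanE : Tendsto (fun n => #(E n) * monoProb (c n) r) atTop (𝓝 a))
    (hmeanF : Tendsto (fun n => #(F n) * monoProb (c n) r) atTop (𝓝 b))
    (hvarE : Tendsto (fun n => edgeCov (c n) r (E n) (E n)) atTop (𝓝 a))
    (hvarF : Tendsto (fun n => edgeCov (c n) r (F n) (F n)) atTop (𝓝 b)) :
    Tendsto (fun n => overlap (c n) (E n ∪ F n)) atTop (𝓝 0) := by
  have h : Tendsto (fun n => 2 * (codegreeEnergy (c n) r (E n) + codegreeEnergy (c n) r (F n)))
      atTop (𝓝 0) := by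
    simpa using ((tendsto_codegreeEnergy hr hc hE hmeanE hvarE).add
      (tendsto_codegreeEnergy hr hc hF hmeanF hvarF)).const_mul 2
  refine tendsto_of_tendsto_of_tendsto_of_le_of_le' tendsto_const_nhds h
    (.of_forall fun n => overlap_nonneg _) ?_
  filter_upwards [hc.eventually_ge_atTop 1] with n hn
  refine (overlap_le_codegreeEnergy hn (r := r) fun e he => ?_).trans
    (codegreeEnergy_union_le r (E n) (F n))
  exact (mem_union.1 he).elim (hE n e) (hF n e)

/-- In the limit only common edges contribute to the cross covariance, since distinct edges
contribute at most `overlap` of the union. -/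
lemma tendsto_card_inter_mul_monoProb (hr : 2 ≤ r) (hc : Tendsto c atTop atTop)
    (hE : ∀ n, ∀ e ∈ E n, #e = r) (hF : ∀ n, ∀ e ∈ F n, #e = r)
    (hmean : Tendsto (fun n => #(E n) * monoProb (c n) r) atTop (𝓝 a))
    (hoverlap : Tendsto (fun n => overlap (c n) (E n ∪ F n)) atTop (𝓝 0))
    (hcov : Tendsto (fun n => edgeCov (c n) r (E n) (F n)) atTop (𝓝 d)) :
    Tendsto (fun n => #(E n ∩ F n) * monoProb (c n) r) atTop (𝓝 d) := by
  have hp := tendsto_monoProb hc hr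
  have h1 : Tendsto (fun n => offDiagCov (c n) r (E n) (F n)) atTop (𝓝 0) := by
    refine tendsto_of_tendsto_of_tendsto_of_le_of_le' tendsto_const_nhds hoverlap ?_ ?_
    all_goals filter_upwards [hc.eventually_ge_atTop 1] with n hn
    · exact offDiagCov_nonneg hn (by omega) (hE n) (hF n)
    · exact offDiagCov_le_overlap hn (by omega) (hE n) (hF n)
  have h2 : Tendsto (fun n => #(E n ∩ F n) * monoProb (c n) r * monoProb (c n) r) atTop (𝓝 0) := by
    refine squeeze_zero (fun n => ?_) (fun n => ?_) (by simpa using hmean.mul hp)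
    · have := monoProb_nonneg (c n) r
      positivity
    · have := monoProb_nonneg (c n) r
      gcongr
      exact inter_subset_left
  have h3 := (hcov.sub h1).add h2
  rw [sub_zero, add_zero] at h3
  refine h3.congr' ?_
  filter_upwards [hc.eventually_ge_atTop 1] with n hn
  rw [edgeCov_eq hn (by omega) (hE n)]
  ring

/-- Convergence of the joint characteristic functions of two numbers of monochromatic edges. -/
lemma tendsto_avg_exp (hr : 2 ≤ r) (hc : Tendsto c atTop atTop)
    (hE : ∀ n, ∀ e ∈ E n, #e = r) (hF : ∀ n, ∀ e ∈ F n, #e = r)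
    (hmeanE : Tendsto (fun n => #(E n) * monoProb (c n) r) atTop (𝓝 a))
    (hmeanF : Tendsto (fun n => #(F n) * monoProb (c n) r) atTop (𝓝 b))
    (hvarE : Tendsto (fun n => edgeCov (c n) r (E n) (E n)) atTop (𝓝 a))
    (hvarF : Tendsto (fun n => edgeCov (c n) r (F n) (F n)) atTop (𝓝 b))
    (hcov : Tendsto (fun n => edgeCov (c n) r (E n) (F n)) atTop (𝓝 d)) (s t : ℝ) :
    Tendsto (fun n => avg (fun x : V n → Fin (c n) =>
      Complex.exp ((s * ∑ e ∈ E n, monoInd e x + t * ∑ e ∈ F n, monoInd e x : ℝ) * Complex.I)))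
      atTop (𝓝 (Complex.exp ((a - d) * (Complex.exp (s * Complex.I) - 1) +
        (b - d) * (Complex.exp (t * Complex.I) - 1) +
        d * (Complex.exp ((s + t) * Complex.I) - 1)))) := by
  have hp := tendsto_monoProb hc hr
  have hover := tendsto_overlap_union hr hc hE hF hmeanE hmeanF hvarE hvarF
  have hinter := tendsto_card_inter_mul_monoProb hr hc hE hF hmeanE hover hcov
  have hunion : Tendsto (fun n => #(E n ∪ F n) * monoProb (c n) r) atTop (𝓝 (a + b - d)) := by
    refine ((hmeanE.add hmeanF).sub hinter).congr fun n => ?_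
    have : (#(E n ∪ F n) : ℝ) + #(E n ∩ F n) = #(E n) + #(F n) := by
      exact_mod_cast card_union_add_card_inter (E n) (F n)
    linear_combination (-monoProb (c n) r) * this
  -- Common edges get weight `s + t`, so one compound Poisson bound for the union treats both counts
  -- jointly.
  set w : ∀ n, Finset (V n) → ℝ := fun n e =>
    (if e ∈ E n then s else 0) + (if e ∈ F n then t else 0) with hw
  have hsum : ∀ n (x : V n → Fin (c n)), edgeSum (E n ∪ F n) (w n) x =
      s * ∑ e ∈ E n, monoInd e x + t * ∑ e ∈ F n, monoInd e x := fun n x => by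
    simp only [edgeSum, hw, add_mul, ite_mul, zero_mul, sum_add_distrib, sum_ite_mem,
      union_inter_cancel_left, union_inter_cancel_right, mul_sum]
  have hexpn : ∀ n, ∑ e ∈ E n ∪ F n,
      (monoProb (c n) r : ℂ) * (Complex.exp ((w n e : ℝ) * Complex.I) - 1) =
      (#(E n) * monoProb (c n) r : ℝ) * (Complex.exp (s * Complex.I) - 1) +
      (#(F n) * monoProb (c n) r : ℝ) * (Complex.exp (t * Complex.I) - 1) +
      (#(E n ∩ F n) * monoProb (c n) r : ℝ) * (Complex.exp ((s + t) * Complex.I) -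
        Complex.exp (s * Complex.I) - Complex.exp (t * Complex.I) + 1) := fun n => by
    have : ∀ e, (monoProb (c n) r : ℂ) * (Complex.exp ((w n e : ℝ) * Complex.I) - 1) =
        (if e ∈ E n then (monoProb (c n) r : ℂ) * (Complex.exp (s * Complex.I) - 1) else 0) +
        (if e ∈ F n then (monoProb (c n) r : ℂ) * (Complex.exp (t * Complex.I) - 1) else 0) +
        (if e ∈ E n ∩ F n then (monoProb (c n) r : ℂ) * (Complex.exp ((s + t) * Complex.I) -
          Complex.exp (s * Complex.I) - Complex.exp (t * Complex.I) + 1) else 0) := fun e => by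
      by_cases h1 : e ∈ E n <;> by_cases h2 : e ∈ F n <;> simp [hw, h1, h2]
      ring
    rw [sum_congr rfl fun e _ => this e]
    simp only [sum_add_distrib, sum_ite_mem, union_inter_cancel_left, union_inter_cancel_right,
      sum_const, nsmul_eq_mul, inter_eq_right.2 (inter_subset_left.trans subset_union_left :
        E n ∩ F n ⊆ E n ∪ F n)]
    push_cast
    ring
  have hmain : Tendsto (fun n => Complex.exp (∑ e ∈ E n ∪ F n,
      (monoProb (c n) r : ℂ) * (Complex.exp ((w n e : ℝ) * Complex.I) - 1))) atTop
      (𝓝 (Complex.exp ((a - d) * (Complex.exp (s * Complex.I) - 1) +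
        (b - d) * (Complex.exp (t * Complex.I) - 1) +
        d * (Complex.exp ((s + t) * Complex.I) - 1)))) := by
    simp only [hexpn]
    have hofReal : ∀ {u : ℕ → ℝ} {l : ℝ}, Tendsto u atTop (𝓝 l) →
        Tendsto (fun n => (u n : ℂ)) atTop (𝓝 (l : ℂ)) := fun h =>
      (Complex.continuous_ofReal.tendsto _).comp h
    convert! (((hofReal hmeanE).mul_const (Complex.exp (s * Complex.I) - 1)).add
      ((hofReal hmeanF).mul_const (Complex.exp (t * Complex.I) - 1))).add
      ((hofReal hinter).mul_const (Complex.exp ((s + t) * Complex.I) -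
        Complex.exp (s * Complex.I) - Complex.exp (t * Complex.I) + 1)) |>.cexp using 3
    ring
  have hbound : Tendsto (fun n => (2 * (|s| + |t|) * (#(E n ∪ F n) * monoProb (c n) r *
      monoProb (c n) r + 2 * overlap (c n) (E n ∪ F n) +
      2 * r ^ 2 * (#(E n ∪ F n) * monoProb (c n) r) *
        √(#(E n ∪ F n) * monoProb (c n) r * monoProb (c n) r + overlap (c n) (E n ∪ F n)))) *
      Real.exp (2 * (#(E n ∪ F n) * monoProb (c n) r))) atTop (𝓝 0) := by
    have h1 := hunion.mul hp
    have h2 := ((h1.add (hover.const_mul 2)).add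
      ((hunion.const_mul (2 * (r : ℝ) ^ 2)).mul (h1.add hover).sqrt)).const_mul (2 * (|s| + |t|))
    simpa using h2.mul (hunion.const_mul 2).rexp
  refine tendsto_of_tendsto_of_dist hmain (squeeze_zero' (.of_forall fun _ => dist_nonneg) ?_ hbound)
  filter_upwards [hc.eventually_ge_atTop 1] with n hn
  have h := norm_avg_exp_edgeSum_sub_le_overlap hn (show 1 ≤ r by omega) (E := E n ∪ F n)
    (fun e he => (mem_union.1 he).elim (hE n e) (hF n e)) (w n) (W := |s| + |t|) (by positivity)
    (fun e _ => by
      refine (abs_add_le _ _).trans (add_le_add ?_ ?_) <;> split_ifs <;> simp)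
  rw [dist_comm, dist_eq_norm]
  simpa only [hsum] using h

end Limit

/-! ### From random variables to averages over colorings -/

section Transfer

/-- Lévy's continuity theorem needs an inner product, so it is applied in `WithLp 2 (ℝ × ℝ)` and
carried back to `ℝ × ℝ` by continuous mapping. -/
lemma tendstoInDistribution_prodMk_of_tendsto_integral_exp {Ω : ℕ → Type*}
    [∀ n, MeasurableSpace (Ω n)] {P : ∀ n, Measure (Ω n)} [∀ n, IsProbabilityMeasure (P n)]
    {Ω' : Type*} [MeasurableSpace Ω'] {P' : Measure Ω'} [IsProbabilityMeasure P']
    {A B : ∀ n, Ω n → ℝ} {Y Z : Ω' → ℝ} (hA : ∀ n, AEMeasurable (A n) (P n))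
    (hB : ∀ n, AEMeasurable (B n) (P n)) (hY : AEMeasurable Y P') (hZ : AEMeasurable Z P')
    (h : ∀ s t : ℝ, Tendsto
      (fun n => ∫ ω, Complex.exp ((s * A n ω + t * B n ω : ℝ) * Complex.I) ∂(P n)) atTop
      (𝓝 (∫ ω, Complex.exp ((s * Y ω + t * Z ω : ℝ) * Complex.I) ∂P'))) :
    TendstoInDistribution (fun n ω => (A n ω, B n ω)) atTop (fun ω => (Y ω, Z ω)) P P' := by
  have hmeas : Measurable (WithLp.toLp 2 : ℝ × ℝ → WithLp 2 (ℝ × ℝ)) := by fun_prop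
  have hAB : ∀ n, AEMeasurable (fun ω => WithLp.toLp 2 (A n ω, B n ω)) (P n) := fun n =>
    hmeas.comp_aemeasurable ((hA n).prodMk (hB n))
  have hYZ : AEMeasurable (fun ω => WithLp.toLp 2 (Y ω, Z ω)) P' :=
    hmeas.comp_aemeasurable (hY.prodMk hZ)
  have key : TendstoInDistribution (fun n ω => WithLp.toLp 2 (A n ω, B n ω)) atTop
      (fun ω => WithLp.toLp 2 (Y ω, Z ω)) P P' := by
    refine ⟨hAB, hYZ, ProbabilityMeasure.tendsto_of_tendsto_charFun fun t => ?_⟩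
    simp only [ProbabilityMeasure.coe_mk, charFun_apply]
    have hm : ∀ μ : Measure (WithLp 2 (ℝ × ℝ)), AEStronglyMeasurable
        (fun x : WithLp 2 (ℝ × ℝ) => Complex.exp (inner ℝ x t * Complex.I)) μ := fun μ => by
      refine Continuous.aestronglyMeasurable ?_
      fun_prop
    rw [integral_map hYZ (hm _)]
    simp_rw [fun n => integral_map (hAB n) (hm _)]
    simpa [WithLp.prod_inner_apply] using h t.fst t.snd
  exact key.continuous_comp (WithLp.prod_continuous_ofLp 2 ℝ ℝ)

variable {V : Type*} [Fintype V]

open Classical in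
/-- The hyperedges of a hypergraph on a finite vertex type, as a finset of finsets. -/
noncomputable def edgeFinset (H : Hypergraph V) : Finset (Finset V) :=
  univ.filter fun e => (e : Set V) ∈ H.edgeSet

lemma card_of_mem_edgeFinset {H : Hypergraph V} {r : ℕ} (hH : IsUniform H r) {e : Finset V}
    (he : e ∈ edgeFinset H) : #e = r := by
  have := hH e (by simpa [edgeFinset] using he)
  rw [Set.encard_coe_eq_coe_finsetCard] at this
  exact_mod_cast this

lemma monoCount_eq_sum {κ : Type*} (H : Hypergraph V) (x : V → κ) :
    (monoCount H x : ℝ) = ∑ e ∈ edgeFinset H, monoInd e x := by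
  classical
  have : {e ∈ H.edgeSet | IsMonochromatic x e} =
      (fun e : Finset V => (e : Set V)) ''
        ({e ∈ edgeFinset H | IsMonochromatic x (e : Set V)} : Finset (Finset V)) := by
    ext e
    simp only [Set.mem_ofPred_eq, Set.mem_image, edgeFinset, coe_filter, mem_filter, mem_univ,
      true_and]
    refine ⟨fun h => ⟨e.toFinset, ?_⟩, ?_⟩
    · simpa using h
    · rintro ⟨e, h, rfl⟩
      exact h
  rw [monoCount, this, Set.ncard_image_of_injective _ coe_injective, Set.ncard_coe_finset,
    card_filter]
  simp only [Nat.cast_sum, monoInd]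
  exact sum_congr rfl fun e _ => by split_ifs <;> simp

lemma T_eq_sum {Ω κ : Type*} (H : Hypergraph V) (X : V → Ω → κ) (ω : Ω) :
    T H X ω = ∑ e ∈ edgeFinset H, monoInd e (fun v => X v ω) :=
  monoCount_eq_sum H _

variable {c : ℕ} {Ω : Type*} [MeasurableSpace Ω] {P : Measure Ω} {X : V → Ω → Fin c}

lemma IsUniformColoring.measurable_T (hX : IsUniformColoring P c X) (H : Hypergraph V) :
    Measurable (T H X) := by
  have hm : Measurable fun ω v => X v ω := measurable_pi_lambda _ hX.measurable
  exact (measurable_of_finite fun x : V → Fin c => (monoCount H x : ℝ)).comp hm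

variable [DecidableEq V] [IsProbabilityMeasure P]

lemma IsUniformColoring.integral_comp (hX : IsUniformColoring P c X) {W : Type*}
    [NormedAddCommGroup W] [NormedSpace ℝ W] [CompleteSpace W] (F : (V → Fin c) → W) :
    ∫ ω, F (fun v => X v ω) ∂P = avg F := by
  have hm : Measurable fun ω v => X v ω := measurable_pi_lambda _ hX.measurable
  have hprob := Measure.isProbabilityMeasure_map (μ := P) hm.aemeasurable
  rw [← integral_map hm.aemeasurable (f := F) (by fun_prop), integral_fintype .of_finite, avg,
    smul_sum]
  refine sum_congr rfl fun x _ => ?_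
  congr 1
  rw [hX.indep.map_fun_eq_pi_map fun v => (hX.measurable v).aemeasurable, measureReal_def,
    Measure.pi_singleton, ENNReal.toReal_prod]
  have : ∀ v, (P.map (X v) {x v}).toReal = 1 / (c : ℝ) := fun v => by
    rw [Measure.map_apply (hX.measurable v) (measurableSet_singleton _)]
    exact hX.uniform v (x v)
  rw [prod_congr rfl fun v _ => this v, prod_const, card_univ, one_div, inv_pow]

lemma IsUniformColoring.integral_T (hX : IsUniformColoring P c X) (hc : 0 < c) {r : ℕ}
    (hr : 1 ≤ r) {H : Hypergraph V} (hH : IsUniform H r) :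
    ∫ ω, T H X ω ∂P = #(edgeFinset H) * monoProb c r := by
  simp only [T_eq_sum]
  rw [hX.integral_comp fun x => ∑ e ∈ edgeFinset H, monoInd e x,
    avg_sum_monoInd hc hr fun e he => card_of_mem_edgeFinset hH he]

lemma IsUniformColoring.covariance_T (hX : IsUniformColoring P c X) (hc : 0 < c) {r : ℕ}
    (hr : 1 ≤ r) {H K : Hypergraph V} (hH : IsUniform H r) (hK : IsUniform K r) :
    covariance (T H X) (T K X) P = edgeCov c r (edgeFinset H) (edgeFinset K) := by
  rw [covariance, hX.integral_T hc hr hH, hX.integral_T hc hr hK]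
  simp only [T_eq_sum]
  rw [hX.integral_comp fun x => (∑ e ∈ edgeFinset H, monoInd e x - _) *
      (∑ e ∈ edgeFinset K, monoInd e x - _),
    avg_sub_mul_sub hc hr (fun e he => card_of_mem_edgeFinset hH he)
      fun e he => card_of_mem_edgeFinset hK he]

end Transfer

/-! ### Characteristic function of the Poisson limit -/

lemma integral_exp_of_hasLaw_poissonMeasure {Ω : Type*} [MeasurableSpace Ω] {P : Measure Ω}
    {Z : Ω → ℕ} {l : ℝ≥0} (hZ : HasLaw Z (poissonMeasure l) P) (t : ℝ) :
    ∫ ω, Complex.exp ((t * Z ω : ℝ) * Complex.I) ∂P =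
      Complex.exp (l * (Complex.exp (t * Complex.I) - 1)) := by
  rw [← charFun_map_cast_poissonMeasure, charFun_apply, integral_map .of_discrete (by fun_prop),
    ← hZ.map_eq, integral_map hZ.aemeasurable .of_discrete]
  simp [mul_comm]

lemma integral_exp_poisson_add {Ω : Type*} [MeasurableSpace Ω] {P : Measure Ω}
    {Z₁ Z₂ Z₁₂ : Ω → ℕ} {l₁ l₂ l₁₂ : ℝ≥0} (hZ₁ : HasLaw Z₁ (poissonMeasure l₁) P)
    (hZ₂ : HasLaw Z₂ (poissonMeasure l₂) P) (hZ₁₂ : HasLaw Z₁₂ (poissonMeasure l₁₂) P)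
    (hZ : iIndepFun ![Z₁, Z₂, Z₁₂] P) (s t : ℝ) :
    ∫ ω, Complex.exp ((s * ((Z₁ ω : ℝ) + Z₁₂ ω) + t * ((Z₂ ω : ℝ) + Z₁₂ ω) : ℝ) * Complex.I) ∂P =
      Complex.exp (l₁ * (Complex.exp (s * Complex.I) - 1) +
        l₂ * (Complex.exp (t * Complex.I) - 1) +
        l₁₂ * (Complex.exp ((s + t) * Complex.I) - 1)) := by
  -- Regrouping the exponent gives the shared variable `Z₁₂` the frequency `s + t`.
  have h := iIndepFun.integral_fun_prod_comp (𝓧 := fun _ : Fin 3 => ℕ) (X := ![Z₁, Z₂, Z₁₂])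
    (f := fun i (n : ℕ) => Complex.exp ((![s, t, s + t] i * (n : ℝ) : ℝ) * Complex.I)) hZ
    (fun i => by fin_cases i <;> simp [hZ₁.aemeasurable, hZ₂.aemeasurable, hZ₁₂.aemeasurable])
    (fun i => by fin_cases i <;> exact .of_discrete)
  simp only [Fin.prod_univ_three] at h
  change ∫ ω, Complex.exp ((s * (Z₁ ω : ℝ) : ℝ) * Complex.I) *
      Complex.exp ((t * (Z₂ ω : ℝ) : ℝ) * Complex.I) *
      Complex.exp (((s + t) * (Z₁₂ ω : ℝ) : ℝ) * Complex.I) ∂P =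
    (∫ ω, Complex.exp ((s * (Z₁ ω : ℝ) : ℝ) * Complex.I) ∂P) *
    (∫ ω, Complex.exp ((t * (Z₂ ω : ℝ) : ℝ) * Complex.I) ∂P) *
    ∫ ω, Complex.exp (((s + t) * (Z₁₂ ω : ℝ) : ℝ) * Complex.I) ∂P at h
  rw [integral_exp_of_hasLaw_poissonMeasure hZ₁, integral_exp_of_hasLaw_poissonMeasure hZ₂,
    integral_exp_of_hasLaw_poissonMeasure hZ₁₂, ← Complex.exp_add, ← Complex.exp_add,
    Complex.ofReal_add] at h
  rw [← h]
  refine integral_congr_ae (.of_forall fun ω => ?_)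
  simp only [← Complex.exp_add]
  congr 1
  push_cast
  ring

end HypergraphColoring

theorem theorem1p2
    (r : ℕ) (hr : 2 ≤ r)
    -- the common finite vertex set and the two layers
    (V : ℕ → Type*) [∀ n, Finite (V n)]
    (H₁ H₂ : ∀ n, Hypergraph (V n))
    (hV₁ : ∀ n, (H₁ n).vertexSet = Set.univ) (hV₂ : ∀ n, (H₂ n).vertexSet = Set.univ)
    (hH₁ : ∀ n, HypergraphColoring.IsUniform (H₁ n) r)
    (hH₂ : ∀ n, HypergraphColoring.IsUniform (H₂ n) r)
    -- the uniformly random colorings with `c n` colors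
    (c : ℕ → ℕ) (hc : Tendsto c atTop atTop)
    (Ω : ℕ → Type*) [∀ n, MeasurableSpace (Ω n)]
    (P : ∀ n, Measure (Ω n)) [∀ n, IsProbabilityMeasure (P n)]
    (X : ∀ n, V n → Ω n → Fin (c n))
    (hX : ∀ n, HypergraphColoring.IsUniformColoring (P n) (c n) (X n))
    -- convergence of the mean vector and of the covariance matrix
    (lam₁ lam₂ lam₁₂ : ℝ≥0) (hlam₁ : lam₁₂ ≤ lam₁) (hlam₂ : lam₁₂ ≤ lam₂)
    (hmean₁ : Tendsto (fun n => ∫ ω, HypergraphColoring.T (H₁ n) (X n) ω ∂(P n))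
      atTop (𝓝 (lam₁ : ℝ)))
    (hmean₂ : Tendsto (fun n => ∫ ω, HypergraphColoring.T (H₂ n) (X n) ω ∂(P n))
      atTop (𝓝 (lam₂ : ℝ)))
    (hvar₁ : Tendsto (fun n => variance (HypergraphColoring.T (H₁ n) (X n)) (P n))
      atTop (𝓝 (lam₁ : ℝ)))
    (hvar₂ : Tendsto (fun n => variance (HypergraphColoring.T (H₂ n) (X n)) (P n))
      atTop (𝓝 (lam₂ : ℝ)))
    (hcov : Tendsto (fun n => covariance (HypergraphColoring.T (H₁ n) (X n))
        (HypergraphColoring.T (H₂ n) (X n)) (P n))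
      atTop (𝓝 (lam₁₂ : ℝ)))
    -- independent Poisson random variables
    {Ω' : Type*} [MeasurableSpace Ω'] (P' : Measure Ω') [IsProbabilityMeasure P']
    (Z₁ Z₂ Z₁₂ : Ω' → ℕ)
    (hZ₁ : HasLaw Z₁ (poissonMeasure (lam₁ - lam₁₂)) P')
    (hZ₂ : HasLaw Z₂ (poissonMeasure (lam₂ - lam₁₂)) P')
    (hZ₁₂ : HasLaw Z₁₂ (poissonMeasure lam₁₂) P')
    (hZ : iIndepFun ![Z₁, Z₂, Z₁₂] P') :
    TendstoInDistribution
      (fun n ω => ((HypergraphColoring.T (H₁ n) (X n) ω,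
        HypergraphColoring.T (H₂ n) (X n) ω) : ℝ × ℝ))
      atTop
      (fun ω => (((Z₁ ω : ℝ) + (Z₁₂ ω : ℝ), (Z₂ ω : ℝ) + (Z₁₂ ω : ℝ)) : ℝ × ℝ))
      P P' := by
  classical
  have := fun n => Fintype.ofFinite (V n)
  have hr1 : 1 ≤ r := by omega
  have hc1 : ∀ᶠ n in atTop, 0 < c n := hc.eventually_ge_atTop 1
  have hmean : ∀ (H : ∀ n, Hypergraph (V n)) (l : ℝ),
      (∀ n, HypergraphColoring.IsUniform (H n) r) →
      Tendsto (fun n => ∫ ω, HypergraphColoring.T (H n) (X n) ω ∂(P n)) atTop (𝓝 l) →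
      Tendsto (fun n => (HypergraphColoring.edgeFinset (H n)).card *
        HypergraphColoring.monoProb (c n) r) atTop (𝓝 l) := fun H l hH h =>
    h.congr' (hc1.mono fun n hn => (hX n).integral_T hn hr1 (hH n))
  have hcov' : ∀ (H K : ∀ n, Hypergraph (V n)) (l : ℝ),
      (∀ n, HypergraphColoring.IsUniform (H n) r) →
      (∀ n, HypergraphColoring.IsUniform (K n) r) →
      Tendsto (fun n => covariance (HypergraphColoring.T (H n) (X n))
        (HypergraphColoring.T (K n) (X n)) (P n)) atTop (𝓝 l) →
      Tendsto (fun n => HypergraphColoring.edgeCov (c n) r (HypergraphColoring.edgeFinset (H n))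
        (HypergraphColoring.edgeFinset (K n))) atTop (𝓝 l) := fun H K l hH hK h =>
    h.congr' (hc1.mono fun n hn => (hX n).covariance_T hn hr1 (hH n) (hK n))
  have hT : ∀ n H, AEMeasurable (HypergraphColoring.T H (X n)) (P n) := fun n H =>
    ((hX n).measurable_T H).aemeasurable
  simp_rw [← covariance_self (hT _ _)] at hvar₁ hvar₂
  have hcast : ∀ {Z : Ω' → ℕ} {l : ℝ≥0}, HasLaw Z (poissonMeasure l) P' →
      AEMeasurable (fun ω => (Z ω : ℝ)) P' := fun h =>
    measurable_from_nat.comp_aemeasurable h.aemeasurable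
  refine HypergraphColoring.tendstoInDistribution_prodMk_of_tendsto_integral_exp
    (fun n => hT n _) (fun n => hT n _) ((hcast hZ₁).add (hcast hZ₁₂))
    ((hcast hZ₂).add (hcast hZ₁₂)) fun s t => ?_
  rw [HypergraphColoring.integral_exp_poisson_add hZ₁ hZ₂ hZ₁₂ hZ s t]
  have key := HypergraphColoring.tendsto_avg_exp hr hc
    (fun n e he => HypergraphColoring.card_of_mem_edgeFinset (hH₁ n) he)
    (fun n e he => HypergraphColoring.card_of_mem_edgeFinset (hH₂ n) he)
    (hmean H₁ _ hH₁ hmean₁) (hmean H₂ _ hH₂ hmean₂) (hcov' H₁ H₁ _ hH₁ hH₁ hvar₁)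
    (hcov' H₂ H₂ _ hH₂ hH₂ hvar₂) (hcov' H₁ H₂ _ hH₁ hH₂ hcov) s t
  have hsub₁ : ((lam₁ - lam₁₂ : ℝ≥0) : ℂ) = ((lam₁ : ℝ) : ℂ) - ((lam₁₂ : ℝ) : ℂ) := by
    rw [← Complex.ofReal_sub, NNReal.coe_sub hlam₁]
  have hsub₂ : ((lam₂ - lam₁₂ : ℝ≥0) : ℂ) = ((lam₂ : ℝ) : ℂ) - ((lam₁₂ : ℝ) : ℂ) := by
    rw [← Complex.ofReal_sub, NNReal.coe_sub hlam₂]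
  rw [hsub₁, hsub₂]
  refine key.congr fun n => ?_
  rw [← (hX n).integral_comp]
  simp only [HypergraphColoring.T_eq_sum]
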